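/- **Model.** A service is a deterministic state machine. Two operations $a,b$ of it *commute* if in every state $s$ executing them in either order leads to the same state, and each of them returns the same response in $s$ as in the state obtained from $s$ by executing the other; otherwise they *conflict*. Commands are operations of the service, tagged so that every command is submitted at most once. There are $n\ge 3$ processes, which may fail by crashing, and which communicate by messages over reliable links. The system is partially synchronous: in each run there is a global stabilization time $\mathsf{GST}$, unknown to the processes, such that every message sent at time $t$ is received by time $\max(t,\mathsf{GST})+\Delta$ (unless its destination has crashed), where $\Delta>0$ is known to the processes; the local clocks may drift arbitrarily before $\mathsf{GST}$ and measure time accurately after it. In a protocol, commands are submitted at processes, and processes execute commands. Local computations are instantaneous. A process acts when it receives a message, when a command is submitted to it, and periodically according to its clock, with a resolution chosen by the protocol. **SMR.** A run satisfies the SMR specification if: (Validity) a process executes a command only if some process has submitted it before; (Integrity) a process executes each command at most once; (Consistency) processes execute conflicting commands in the same order; (Liveness) if only finitely many commands are submitted, then each command that is submitted by a correct process or executed at some process is eventually executed at all correct processes. A protocol is an *$f$-resilient SMR protocol* if all its runs with at most $f$ faulty processes satisfy the SMR specification. **Fast protocols.** For a set $E$ of processes, a run is *$E$-faulty synchronous*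 if all processes in $E$ crash at time $0$, all others are correct, the system is stable from the beginning ($\mathsf{GST}=0$), and all messages sent during a round $[j\Delta,(j+1)\Delta)$ are delivered at time $(j+1)\Delta$. A command $c$ *precedes* $c'$ if $c'$ is submitted at a process that has already executed $c$; two commands are *concurrent* if neither precedes the other; $c$ is *conflict-free* if it does not conflict with any other command that is submitted in the run and concurrent with it. A protocol is *$e$-fast* if for every set $E$ of exactly $e$ processes, in every $E$-faulty synchronous run, each conflict-free command submitted at time $t$ by a process $p$ is executed at $p$ by time $t+2\Delta$. **Theorem.** Let $e\le f$, and consider a service that has two (not necessarily different) conflicting operations. If there is an $f$-resilient $e$-fast SMR protocol for this service and $n\ge 3$ processes, then $$n \ge \max\{2e+f-1,\ 2f+1\}.$$ -/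

import Mathlib

/-! State-machine replication in a partially synchronous message-passing system with crash
failures: services, protocols, runs, and the notions of `f`-resilient and `e`-fast protocols. -/

namespace SMR

/-! ### Services -/

/-- A service: a deterministic state machine with states `S`, operations `Op`, responses `R`. -/
structure StateMachine (S Op R : Type*) where
  init : S
  apply : S → Op → S × R

namespace StateMachine

variable {S Op R : Type*}

/-- Two operations commute if, in every state, the order in which they are executed influences
neither the resulting state nor any of the two responses. -/
def Commute (M : StateMachine S Op R) (a b : Op) : Prop :=
  ∀ s : S,
    (M.apply (M.apply s a).1 b).1 = (M.apply (M.apply s b).1 a).1 ∧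
    (M.apply s a).2 = (M.apply (M.apply s b).1 a).2 ∧
    (M.apply s b).2 = (M.apply (M.apply s a).1 b).2

/-- Two operations conflict if they do not commute. -/
def Conflict (M : StateMachine S Op R) (a b : Op) : Prop := ¬ M.Commute a b

end StateMachine

/-- A command: an operation of the service together with a tag. The tag has no influence on the
state machine; it only serves to make all submitted commands distinct. -/
structure Command (Op : Type*) where
  op : Op
  tag : ℕ

/-! ### Protocols -/

universe u v w

/-- The result of one local step: the new local state, the messages sent (with their
destinations), and the commands executed, in the order of their execution. -/
structure Outcome (n : ℕ) (Op State Msg : Type*) where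
  state : State
  sends : List (Fin n × Msg)
  executes : List (Command Op)

/-- A (possibly nondeterministic) message-passing protocol for `n` replicas.

In a step a replica `p` in state `s` reads its local clock, takes in the list of commands submitted
to it and the list of (sender, message) pairs that it receives, and produces an outcome out of the
nonempty set `step p s reading submissions messages`.

A replica takes a step whenever it gets an input, and also whenever its local clock shows an
integer multiple of `Δ / ticks`; the resolution `ticks` is chosen by the protocol. This is how
timers are programmed. -/
structure Protocol (n : ℕ) (Op : Type u) where
  State : Type v
  Msg : Type w
  init : Fin n → State
  ticks : ℕ
  ticks_pos : 0 < ticks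
  step : Fin n → State → ℝ → List (Command Op) → List (Fin n × Msg) →
    Set (Outcome n Op State Msg)
  step_nonempty : ∀ p s reading submissions messages,
    (step p s reading submissions messages).Nonempty

/-- The name of a message: the `idx`-th message sent by `src` at the `instant`-th instant of a run. -/
structure MsgId (n : ℕ) where
  src : Fin n
  instant : ℕ
  idx : ℕ

/-! ### Runs -/

/-- A run of the protocol `P` in the partially synchronous system with delay bound `Δ`.

All events of the run take place at the instants `time 0 < time 1 < ⋯`, which tend to infinity;
which of the replicas are active at an instant is determined by the inputs and the clocks. -/
structure Run {n : ℕ} {Op : Type*} (P : Protocol n Op) (Δ : ℝ) where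
  /-- The real times at which events take place. -/
  time : ℕ → ℝ
  /-- The global stabilization time. -/
  gst : ℝ
  /-- The time at which a replica crashes, `⊤` if it never does. A replica takes no step at or
  after that time. -/
  crash : Fin n → WithTop ℝ
  /-- The reading of the local clock of a replica as a function of real time. -/
  clock : Fin n → ℝ → ℝ
  /-- The commands submitted at a replica at an instant. -/
  submits : ℕ → Fin n → List (Command Op)
  /-- The messages received by a replica at an instant. -/
  receives : ℕ → Fin n → List (MsgId n)
  /-- The local state of a replica just before an instant. -/
  state : ℕ → Fin n → P.State
  /-- The messages sent by a replica at an instant, with their destinations. -/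
  sends : ℕ → Fin n → List (Fin n × P.Msg)
  /-- The commands executed by a replica at an instant, in the order of execution. -/
  executes : ℕ → Fin n → List (Command Op)
  time_nonneg : 0 ≤ time 0
  time_strictMono : StrictMono time
  time_tendsto : Filter.Tendsto time Filter.atTop Filter.atTop
  gst_nonneg : 0 ≤ gst
  crash_nonneg : ∀ p, 0 ≤ crash p
  /-- Clocks run continuously, at an arbitrary and varying speed, ... -/
  clock_continuousOn : ∀ p, ContinuousOn (clock p) (Set.Ici 0)
  clock_strictMonoOn : ∀ p, StrictMonoOn (clock p) (Set.Ici 0)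
  /-- ... but measure time accurately from the global stabilization time on. -/
  clock_accurate : ∀ p s t, gst ≤ s → s ≤ t → clock p t - clock p s = t - s
  /-- A crashed replica gets no inputs. -/
  submits_alive : ∀ k p, submits k p ≠ [] → (time k : WithTop ℝ) < crash p
  receives_alive : ∀ k p, receives k p ≠ [] → (time k : WithTop ℝ) < crash p
  /-- Each command is submitted at most once. -/
  submits_nodup : ∀ k p, (submits k p).Nodup
  submits_unique : ∀ c k p k' p', c ∈ submits k p → c ∈ submits k' p' → k = k' ∧ p = p'
  /-- A received message has been sent earlier, to the replica that receives it. -/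
  receives_sent : ∀ k p i, i ∈ receives k p →
    i.instant < k ∧ ∃ m, (sends i.instant i.src)[i.idx]? = some (p, m)
  /-- No message is received twice. -/
  receives_nodup : ∀ k p, (receives k p).Nodup
  receives_unique : ∀ i k k' p, i ∈ receives k p → i ∈ receives k' p → k = k'
  /-- Links are reliable, and messages take at most `Δ` after the global stabilization time:
  a message sent at time `t` is received by time `max gst t + Δ`, unless its destination has
  crashed by then. -/
  receives_timely : ∀ i p m, (sends i.instant i.src)[i.idx]? = some (p, m) →
    ((max gst (time i.instant) + Δ : ℝ) : WithTop ℝ) < crash p →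
    ∃ k, i ∈ receives k p ∧ time k ≤ max gst (time i.instant) + Δ
  /-- The points in time at which the clock of a live replica triggers a step are instants. -/
  tick_instant : ∀ p (t : ℝ) (j : ℤ), 0 ≤ t → (t : WithTop ℝ) < crash p →
    clock p t = j * (Δ / P.ticks) → ∃ k, time k = t
  state_zero : ∀ p, state 0 p = P.init p
  /-- A live replica with an input or a clock trigger takes a step according to the protocol. -/
  step_active : ∀ k p, (time k : WithTop ℝ) < crash p →
    (submits k p ≠ [] ∨ receives k p ≠ [] ∨ ∃ j : ℤ, clock p (time k) = j * (Δ / P.ticks)) →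
    (⟨state (k + 1) p, sends k p, executes k p⟩ : Outcome n Op P.State P.Msg) ∈
      P.step p (state k p) (clock p (time k)) (submits k p)
        ((receives k p).filterMap fun i =>
          ((sends i.instant i.src)[i.idx]?).map fun x => (i.src, x.2))
  /-- Otherwise the replica does nothing. -/
  step_idle : ∀ k p, ¬ ((time k : WithTop ℝ) < crash p ∧
      (submits k p ≠ [] ∨ receives k p ≠ [] ∨
        ∃ j : ℤ, clock p (time k) = j * (Δ / P.ticks))) →
    state (k + 1) p = state k p ∧ sends k p = [] ∧ executes k p = []

namespace Run

variable {n : ℕ} {Op S R : Type*} {P : Protocol n Op} {Δ : ℝ}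

/-- A replica is correct in a run if it never crashes; otherwise it is faulty. -/
def Correct (r : Run P Δ) (p : Fin n) : Prop := r.crash p = ⊤

/-- The command `c` is submitted in the run (at some replica). -/
def Submitted (r : Run P Δ) (c : Command Op) : Prop := ∃ k p, c ∈ r.submits k p

/-- The replica `p` executes the command `c`. -/
def Executes (r : Run P Δ) (p : Fin n) (c : Command Op) : Prop := ∃ k, c ∈ r.executes k p

/-- The replica `p` executes `c` and, later, `c'`. -/
def ExecutesBefore (r : Run P Δ) (p : Fin n) (c c' : Command Op) : Prop :=
  ∃ k i k' i' : ℕ, (r.executes k p)[i]? = some c ∧ (r.executes k' p)[i']? = some c' ∧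
    (k < k' ∨ k = k' ∧ i < i')

/-! #### The specification of state-machine replication -/

/-- A command that is executed has been submitted before. -/
def Validity (r : Run P Δ) : Prop :=
  ∀ k p c, c ∈ r.executes k p → ∃ k' p', k' ≤ k ∧ c ∈ r.submits k' p'

/-- A replica executes each command at most once. -/
def Integrity (r : Run P Δ) : Prop :=
  ∀ (p : Fin n) (c : Command Op) (k i k' i' : ℕ), (r.executes k p)[i]? = some c → (r.executes k' p)[i']? = some c →
    k = k' ∧ i = i'

/-- Replicas execute conflicting commands in the same order. -/
def Consistency (M : StateMachine S Op R) (r : Run P Δ) : Prop :=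
  ∀ p q c c', c ≠ c' → M.Conflict c.op c'.op →
    r.ExecutesBefore p c c' → ¬ r.ExecutesBefore q c' c

/-- If only finitely many commands are submitted, then each command that is submitted at a correct
replica or executed at some replica is executed at all correct replicas. -/
def Liveness (r : Run P Δ) : Prop :=
  {c | r.Submitted c}.Finite →
    ∀ c, ((∃ k p, r.Correct p ∧ c ∈ r.submits k p) ∨ ∃ p, r.Executes p c) →
      ∀ q, r.Correct q → r.Executes q c

/-- The run satisfies the specification of state-machine replication for the service `M`. -/
def IsSMR (M : StateMachine S Op R) (r : Run P Δ) : Prop :=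
  r.Validity ∧ r.Integrity ∧ r.Consistency M ∧ r.Liveness

/-! #### Fast runs -/

/-- `c` precedes `c'` if `c'` is submitted at a replica that has already executed `c`. -/
def Precedes (r : Run P Δ) (c c' : Command Op) : Prop :=
  ∃ p k k', c ∈ r.executes k p ∧ c' ∈ r.submits k' p ∧ k < k'

/-- Commands are concurrent if neither precedes the other. -/
def Concurrent (r : Run P Δ) (c c' : Command Op) : Prop :=
  ¬ r.Precedes c c' ∧ ¬ r.Precedes c' c

/-- `c` does not conflict with any concurrent (other) command of the run. -/
def ConflictFree (M : StateMachine S Op R) (r : Run P Δ) (c : Command Op) : Prop :=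
  ∀ c', r.Submitted c' → c' ≠ c → r.Concurrent c c' → ¬ M.Conflict c.op c'.op

/-- Each conflict-free command submitted by `p` at time `t` is executed at `p` by `t + 2Δ`. -/
def IsFast (M : StateMachine S Op R) (r : Run P Δ) : Prop :=
  ∀ c k p, c ∈ r.submits k p → r.ConflictFree M c →
    ∃ k', c ∈ r.executes k' p ∧ r.time k' ≤ r.time k + 2 * Δ

/-- `E`-faulty synchronous runs: the replicas in `E` crash at the beginning, all others are
correct, the system is stable from the beginning (so that clocks measure time accurately), and each
message sent during a round `[jΔ, (j+1)Δ)` is received at the beginning of the next one. -/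
def FaultySynchronous (r : Run P Δ) (E : Finset (Fin n)) : Prop :=
  (∀ p ∈ E, r.crash p = 0) ∧ (∀ p ∉ E, r.Correct p) ∧ r.gst = 0 ∧
  ∀ (i : MsgId n) (p : Fin n) (m : P.Msg) (j : ℕ), p ∉ E →
    (r.sends i.instant i.src)[i.idx]? = some (p, m) →
    j * Δ ≤ r.time i.instant → r.time i.instant < (j + 1) * Δ →
    ∃ k, i ∈ r.receives k p ∧ r.time k = (j + 1) * Δ

end Run

/-! ### Resilient and fast protocols -/

/-- A protocol is `f`-resilient if it implements state-machine replication in all runs with at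
most `f` faulty replicas. -/
def Protocol.Resilient {n : ℕ} {Op S R : Type*} (P : Protocol n Op) (M : StateMachine S Op R)
    (Δ : ℝ) (f : ℕ) : Prop :=
  ∀ r : Run P Δ, {p | ¬ r.Correct p}.ncard ≤ f → r.IsSMR M

/-- A protocol is `e`-fast if, for all sets `E` of `e` replicas, each of its `E`-faulty synchronous
runs is fast. -/
def Protocol.Fast {n : ℕ} {Op S R : Type*} (P : Protocol n Op) (M : StateMachine S Op R)
    (Δ : ℝ) (e : ℕ) : Prop :=
  ∀ E : Finset (Fin n), E.card = e → ∀ r : Run P Δ, r.FaultySynchronous E → r.IsFast M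

end SMR

/-! The lower bound rests on runs that no replica can tell apart. All of them are generated by an
adversary (`Schedule`) under which clocks are accurate, all events happen at multiples of the clock
resolution, and nondeterminism is resolved by one fixed choice function. Then a replica's behaviour
is a function of the inputs it gets, and two runs that give the same inputs to a causally closed set
of steps agree on it (`Schedule.outcome_eq_of_agree`).

*`n ≥ 2f + 1`* (`Schedule.two_mul_lt_of_resilient`). Otherwise the replicas split into two parts of
at most `f` replicas. Each part, if the other one has crashed, executes a command of its own. If
instead both are alive but cannot communicate for long enough, both do this with conflicting
commands, and they execute the two commands in opposite orders.

*`n ≥ 2e + f - 1`* (`Schedule.Duel.not_resilient_of_fast`). Otherwise there are sets `E₀`, `E₁` of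
`e` replicas and proposers `p₀ ∈ E₁ \ E₀`, `p₁ ∈ E₀ \ E₁` such that at most `f` replicas are
proposers or lie outside `E₀ ∪ E₁` (`Schedule.exists_duel`). Call the others, which exist since
`n > f`, survivors. Let both proposers submit conflicting commands `c₀`, `c₁`. Being fast, `pᵢ` has
to execute `cᵢ` after two rounds if it hears only from the replicas outside `Eᵢ`; these must have
heard only from each other in the first round. A survivor lies outside at most one of `E₀`, `E₁`,
so its inputs in the first round can be chosen to suit both fast decisions. Let all replicas except
the survivors fall silent for the survivors after that round. The survivors then cannot distinguish
three runs: the two in which `p₀` or `p₁` decides fast and messages are merely late, and the one in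
which the other replicas, at most `f` many, have crashed.

In the last run nobody need ever execute `c₀` or `c₁`, as their submitters are faulty. Therefore a
survivor also submits probes `d₀`, `d₁`, where `dᵢ` conflicts with `cᵢ`. By liveness it executes
them by some instant `T` in the run with crashes, hence in all three runs if messages are late
enough. In the run in which `pᵢ` decides fast, `cᵢ` is executed before `dᵢ`; hence the survivor
executes both `c₀` and `c₁` by `T`, in an order that is the same in the three runs. But the run in
which `pᵢ` decides fast requires `cᵢ` to come first. -/

namespace SMR

universe u v w

/-! ### Runs generated by schedules -/

/-- The choices of an adversary who lets all events happen at the points in time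
`0, Δ/N, 2Δ/N, …`, numbered by the naturals: the instant `crashAt p` from which on `p` takes no
step, the instant `gst` of global stabilization, the submitted commands, and the instant
`delivery src j dst` at which the messages that `src` sends to `dst` at the instant `j` arrive.
The delivery instant is unconstrained for a sender that is dead at the instant `j`. -/
structure Schedule (n N : ℕ) (Op : Type u) where
  crashAt : Fin n → WithTop ℕ
  gst : ℕ
  submits : ℕ → Fin n → List (Command Op)
  delivery : Fin n → ℕ → Fin n → ℕ
  submits_alive : ∀ k p, submits k p ≠ [] → (k : WithTop ℕ) < crashAt p
  submits_nodup : ∀ k p, (submits k p).Nodup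
  submits_unique : ∀ c k p k' p', c ∈ submits k p → c ∈ submits k' p' → k = k' ∧ p = p'
  lt_delivery : ∀ src (j : ℕ) dst, (j : WithTop ℕ) < crashAt src → j < delivery src j dst
  delivery_le : ∀ src (j : ℕ) dst, (j : WithTop ℕ) < crashAt src → delivery src j dst ≤ max gst j + N

namespace Schedule

variable {n : ℕ} {Op : Type u} (P : Protocol.{u, v, w} n Op) (Δ : ℝ)
  (σ : Schedule n P.ticks Op)

open Classical in
/-- The messages that arrive at `p` at the instant `k`, if `h` records the messages sent at each
instant. They are listed in an order that depends only on the set of their names. -/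
noncomputable def arrivals (h : ℕ → Fin n → List (Fin n × P.Msg)) (k : ℕ) (p : Fin n) :
    List (MsgId n) :=
  if (k : WithTop ℕ) < σ.crashAt p then
    ((Finset.univ.biUnion fun src => (Finset.range k).biUnion fun j =>
      (Finset.range (h j src).length).image fun idx => (⟨src, j, idx⟩ : MsgId n)).filter
        fun i => σ.delivery i.src i.instant p = k ∧
          ∃ m, (h i.instant i.src)[i.idx]? = some (p, m)).toList
  else []

open Classical in
/-- The outcome of the step of `p` at the instant `k`. A nondeterministic step is resolved by a
choice function, so that equal inputs give equal outcomes, also across schedules. -/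
noncomputable def outcomeOf (s : P.State) (h : ℕ → Fin n → List (Fin n × P.Msg)) (k : ℕ)
    (p : Fin n) : Outcome n Op P.State P.Msg :=
  if (k : WithTop ℕ) < σ.crashAt p then
    (P.step_nonempty p s (k * (Δ / P.ticks)) (σ.submits k p)
      ((σ.arrivals P h k p).filterMap fun i =>
        ((h i.instant i.src)[i.idx]?).map fun x => (i.src, x.2))).some
  else ⟨s, [], []⟩

/-- The local states just before the instant `k`, and the messages sent at the instants before `k`
(none being recorded for later instants). -/
noncomputable def config : ℕ → (Fin n → P.State) × (ℕ → Fin n → List (Fin n × P.Msg))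
  | 0 => (P.init, fun _ _ => [])
  | k + 1 =>
    (fun p => (σ.outcomeOf P Δ ((config k).1 p) (config k).2 k p).state,
      Function.update (config k).2 k
        fun p => (σ.outcomeOf P Δ ((config k).1 p) (config k).2 k p).sends)

/-- The outcome of the step of `p` at the instant `k` of the run generated by the schedule. -/
noncomputable def outcome (k : ℕ) (p : Fin n) : Outcome n Op P.State P.Msg :=
  σ.outcomeOf P Δ ((σ.config P Δ k).1 p) (σ.config P Δ k).2 k p

/-- The messages sent in the run generated by the schedule. -/
noncomputable def sent (j : ℕ) (p : Fin n) : List (Fin n × P.Msg) := (σ.outcome P Δ j p).sends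

theorem config_snd (k j : ℕ) (hj : j < k) : (σ.config P Δ k).2 j = σ.sent P Δ j := by
  induction k with
  | zero => omega
  | succ k ih =>
    rcases Nat.lt_succ_iff_lt_or_eq.mp hj with h | rfl
    · simp only [config, Function.update_of_ne h.ne]
      exact ih h
    · simp only [config, Function.update_self]
      rfl

theorem mem_arrivals {h : ℕ → Fin n → List (Fin n × P.Msg)} {k : ℕ} {p : Fin n} {i : MsgId n} :
    i ∈ σ.arrivals P h k p ↔ (k : WithTop ℕ) < σ.crashAt p ∧ i.instant < k ∧
      σ.delivery i.src i.instant p = k ∧ ∃ m, (h i.instant i.src)[i.idx]? = some (p, m) := by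
  unfold arrivals
  split_ifs with hk
  · simp only [Finset.mem_toList, Finset.mem_filter, Finset.mem_biUnion, Finset.mem_univ,
      true_and, Finset.mem_range, Finset.mem_image, hk]
    constructor
    · rintro ⟨⟨src, j, hj, idx, -, rfl⟩, h⟩
      exact ⟨hj, h⟩
    · rintro ⟨hj, hd, m, hm⟩
      exact ⟨⟨i.src, i.instant, hj, i.idx, (List.getElem?_eq_some_iff.mp hm).1, rfl⟩, hd, m, hm⟩
  · simp [hk]

theorem nodup_arrivals (h : ℕ → Fin n → List (Fin n × P.Msg)) (k : ℕ) (p : Fin n) :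
    (σ.arrivals P h k p).Nodup := by
  unfold arrivals
  split_ifs
  · exact Finset.nodup_toList _
  · exact List.nodup_nil

/-- Arrivals, and the outcome of a step, depend only on the inputs of the step: on whether the
replica is alive, on the submitted commands, and on the arriving messages. -/
theorem outcomeOf_congr {σ τ : Schedule n P.ticks Op}
    {h h' : ℕ → Fin n → List (Fin n × P.Msg)} {k : ℕ} {p : Fin n} (s : P.State)
    (halive : (k : WithTop ℕ) < σ.crashAt p ↔ (k : WithTop ℕ) < τ.crashAt p)
    (hsub : σ.submits k p = τ.submits k p)
    (hdel : ∀ src j, j < k → (σ.delivery src j p = k ↔ τ.delivery src j p = k))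
    (hsent : ∀ src j, j < k → σ.delivery src j p = k → h j src = h' j src) :
    σ.arrivals P h k p = τ.arrivals P h' k p ∧
      σ.outcomeOf P Δ s h k p = τ.outcomeOf P Δ s h' k p := by
  classical
  have harr : σ.arrivals P h k p = τ.arrivals P h' k p := by
    by_cases ha : (k : WithTop ℕ) < σ.crashAt p
    · have ha' := halive.mp ha
      unfold arrivals
      rw [if_pos ha, if_pos ha']
      congr 1
      ext i
      have key := σ.mem_arrivals P (h := h) (k := k) (p := p) (i := i)
      have key' := τ.mem_arrivals P (h := h') (k := k) (p := p) (i := i)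
      unfold arrivals at key key'
      rw [if_pos ha, Finset.mem_toList] at key
      rw [if_pos ha', Finset.mem_toList] at key'
      rw [key, key']
      constructor
      · rintro ⟨-, hj, hd, hm⟩
        exact ⟨ha', hj, (hdel _ _ hj).mp hd, by rwa [← hsent _ _ hj hd]⟩
      · rintro ⟨-, hj, hd, hm⟩
        have hd' := (hdel _ _ hj).mpr hd
        exact ⟨ha, hj, hd', by rwa [hsent _ _ hj hd']⟩
    · have ha' := fun h => ha (halive.mpr h)
      unfold arrivals
      rw [if_neg ha, if_neg ha']
  refine ⟨harr, ?_⟩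
  have hmsgs : ((σ.arrivals P h k p).filterMap fun i =>
        ((h i.instant i.src)[i.idx]?).map fun x => (i.src, x.2)) =
      (τ.arrivals P h' k p).filterMap fun i =>
        ((h' i.instant i.src)[i.idx]?).map fun x => (i.src, x.2) := by
    rw [← harr]
    refine List.filterMap_congr fun i hi => ?_
    obtain ⟨-, hj, hd, -⟩ := (σ.mem_arrivals P).mp hi
    rw [hsent _ _ hj hd]
  unfold outcomeOf
  by_cases ha : (k : WithTop ℕ) < σ.crashAt p
  · rw [if_pos ha, if_pos (halive.mp ha)]
    simp only [hmsgs, hsub]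
  · rw [if_neg ha, if_neg fun h => ha (halive.mpr h)]

/-- Indistinguishability. If two schedules give the same inputs to the replicas on a set `D` of
pairs (instant, replica) that is closed under causality, then their runs agree on `D`. -/
theorem outcome_eq_of_agree {σ τ : Schedule n P.ticks Op} (D : ℕ → Fin n → Prop)
    (hD : ∀ k p, D (k + 1) p → D k p)
    (halive : ∀ k p, D k p → ((k : WithTop ℕ) < σ.crashAt p ↔ (k : WithTop ℕ) < τ.crashAt p))
    (hsub : ∀ k p, D k p → σ.submits k p = τ.submits k p)
    (hdel : ∀ k p, D k p → ∀ src j, j < k → (σ.delivery src j p = k ↔ τ.delivery src j p = k))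
    (hcausal : ∀ k p, D k p → ∀ src j, j < k → σ.delivery src j p = k → D j src) :
    ∀ k p, D k p → σ.outcome P Δ k p = τ.outcome P Δ k p := by
  intro k
  induction k using Nat.strong_induction_on with
  | _ k ih =>
    intro p hp
    have hstate : (σ.config P Δ k).1 p = (τ.config P Δ k).1 p := by
      cases k with
      | zero => rfl
      | succ k => exact congrArg Outcome.state (ih k k.lt_succ_self p (hD k p hp))
    unfold outcome
    rw [← hstate]
    refine (outcomeOf_congr P Δ _ (halive k p hp) (hsub k p hp) (hdel k p hp) ?_).2
    intro src j hj hd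
    rw [config_snd P Δ σ k j hj, config_snd P Δ τ k j hj]
    exact congrArg Outcome.sends (ih j hj src (hcausal k p hp src j hj hd))

theorem outcome_of_dead {k : ℕ} {p : Fin n} (h : ¬ (k : WithTop ℕ) < σ.crashAt p) :
    σ.outcome P Δ k p = ⟨(σ.config P Δ k).1 p, [], []⟩ := if_neg h

/-- The crash time, in real time. -/
noncomputable def crashTime (p : Fin n) : WithTop ℝ :=
  (σ.crashAt p).map fun k : ℕ => (k : ℝ) * (Δ / P.ticks)

variable {Δ} in
theorem lt_crashTime_iff (hΔ : 0 < Δ) (k : ℕ) (p : Fin n) :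
    (((k : ℝ) * (Δ / P.ticks) : ℝ) : WithTop ℝ) < σ.crashTime P Δ p ↔
      (k : WithTop ℕ) < σ.crashAt p := by
  have hδ : 0 < Δ / P.ticks := div_pos hΔ (Nat.cast_pos.mpr P.ticks_pos)
  unfold crashTime
  cases h : σ.crashAt p with
  | top => exact iff_of_true (WithTop.coe_lt_top _) (WithTop.coe_lt_top k)
  | coe a =>
    rw [WithTop.map_coe, WithTop.coe_lt_coe, mul_lt_mul_iff_left₀ hδ, Nat.cast_lt]
    exact WithTop.coe_lt_coe.symm

variable {Δ} in
theorem ticks_mul (hΔ : 0 < Δ) : (P.ticks : ℝ) * (Δ / P.ticks) = Δ := by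
  have : (P.ticks : ℝ) ≠ 0 := Nat.cast_ne_zero.mpr P.ticks_pos.ne'
  field_simp

variable {Δ} in
/-- The run generated by a schedule: all clocks are accurate throughout, so that each live replica
takes a step at each instant. -/
noncomputable def run (hΔ : 0 < Δ) : Run P Δ where
  time k := k * (Δ / P.ticks)
  gst := σ.gst * (Δ / P.ticks)
  crash := σ.crashTime P Δ
  clock _ t := t
  submits := σ.submits
  receives k p := σ.arrivals P (σ.sent P Δ) k p
  state k p := (σ.config P Δ k).1 p
  sends := σ.sent P Δ
  executes k p := (σ.outcome P Δ k p).executes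
  time_nonneg := by simp
  time_strictMono := by
    have hδ : 0 < Δ / P.ticks := div_pos hΔ (Nat.cast_pos.mpr P.ticks_pos)
    intro a b h
    exact mul_lt_mul_of_pos_right (Nat.cast_lt.mpr h) hδ
  time_tendsto :=
    tendsto_natCast_atTop_atTop.atTop_mul_const (div_pos hΔ (Nat.cast_pos.mpr P.ticks_pos))
  gst_nonneg := by positivity
  crash_nonneg p := by
    unfold crashTime
    cases σ.crashAt p with
    | top => exact le_top
    | coe a =>
      rw [WithTop.map_coe]
      exact WithTop.coe_le_coe.mpr (by positivity)
  clock_continuousOn _ := continuousOn_id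
  clock_strictMonoOn _ := strictMonoOn_id
  clock_accurate _ _ _ _ _ := rfl
  submits_alive k p h := (σ.lt_crashTime_iff P hΔ k p).mpr (σ.submits_alive k p h)
  receives_alive k p h := by
    obtain ⟨i, hi⟩ := List.exists_mem_of_ne_nil _ h
    exact (σ.lt_crashTime_iff P hΔ k p).mpr ((σ.mem_arrivals P).mp hi).1
  submits_nodup := σ.submits_nodup
  submits_unique := σ.submits_unique
  receives_sent k p i h := by
    obtain ⟨-, h1, -, h2⟩ := (σ.mem_arrivals P).mp h
    exact ⟨h1, h2⟩
  receives_nodup k p := σ.nodup_arrivals P _ k p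
  receives_unique i k k' p h h' :=
    ((σ.mem_arrivals P).mp h).2.2.1.symm.trans ((σ.mem_arrivals P).mp h').2.2.1
  receives_timely i p m hm hc := by
    have hδ : 0 < Δ / P.ticks := div_pos hΔ (Nat.cast_pos.mpr P.ticks_pos)
    have hsrc : (i.instant : WithTop ℕ) < σ.crashAt i.src := by
      by_contra h
      simp [sent, σ.outcome_of_dead P Δ h] at hm
    have hle : (σ.delivery i.src i.instant p : ℝ) * (Δ / P.ticks) ≤
        max (σ.gst * (Δ / P.ticks)) (i.instant * (Δ / P.ticks)) + Δ := by
      have h : (σ.delivery i.src i.instant p : ℝ) ≤ max (σ.gst : ℝ) i.instant + P.ticks := by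
        exact_mod_cast σ.delivery_le i.src i.instant p hsrc
      calc _ ≤ (max (σ.gst : ℝ) i.instant + P.ticks) * (Δ / P.ticks) :=
            mul_le_mul_of_nonneg_right h hδ.le
        _ = _ := by rw [add_mul, ticks_mul P hΔ, max_mul_of_nonneg _ _ hδ.le]
    refine ⟨_, (σ.mem_arrivals P).mpr ⟨?_, σ.lt_delivery _ _ p hsrc, rfl, m, hm⟩, hle⟩
    exact (σ.lt_crashTime_iff P hΔ _ p).mp ((WithTop.coe_le_coe.mpr hle).trans_lt hc)
  tick_instant p t j ht _ h := by
    have hδ : 0 < Δ / P.ticks := div_pos hΔ (Nat.cast_pos.mpr P.ticks_pos)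
    have hj : 0 ≤ j := by
      by_contra! hj
      have : (j : ℝ) * (Δ / P.ticks) < 0 := mul_neg_of_neg_of_pos (Int.cast_lt_zero.mpr hj) hδ
      linarith
    lift j to ℕ using hj
    exact ⟨j, by rw [h, Int.cast_natCast]⟩
  state_zero _ := rfl
  step_active k p ha _ := by
    have ha' := (σ.lt_crashTime_iff P hΔ k p).mp ha
    have heq : σ.outcome P Δ k p =
        σ.outcomeOf P Δ ((σ.config P Δ k).1 p) (σ.sent P Δ) k p :=
      (outcomeOf_congr P Δ _ Iff.rfl rfl (fun _ _ _ => Iff.rfl) fun src j hj _ => by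
        rw [config_snd P Δ σ k j hj]).2
    change σ.outcome P Δ k p ∈ _
    rw [heq, outcomeOf, if_pos ha']
    exact Set.Nonempty.some_mem _
  step_idle k p h := by
    have hd : ¬ (k : WithTop ℕ) < σ.crashAt p := fun ha =>
      h ⟨(σ.lt_crashTime_iff P hΔ k p).mpr ha, Or.inr (Or.inr ⟨k, by simp⟩)⟩
    have := σ.outcome_of_dead P Δ hd
    refine ⟨?_, ?_, ?_⟩
    · exact congrArg Outcome.state this
    · exact congrArg Outcome.sends this
    · exact congrArg Outcome.executes this

variable {Δ}

theorem run_correct_iff (hΔ : 0 < Δ) (p : Fin n) :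
    (σ.run P hΔ).Correct p ↔ σ.crashAt p = ⊤ := by
  change σ.crashTime P Δ p = ⊤ ↔ _
  unfold crashTime
  cases σ.crashAt p with
  | top => exact iff_of_true rfl rfl
  | coe a => exact iff_of_false (WithTop.coe_ne_top (α := ℝ)) WithTop.coe_ne_top

theorem executes_eq_of_outcome_eq {σ τ : Schedule n P.ticks Op} (hΔ : 0 < Δ) {k : ℕ} {p : Fin n}
    (h : σ.outcome P Δ k p = τ.outcome P Δ k p) :
    (σ.run P hΔ).executes k p = (τ.run P hΔ).executes k p := congrArg Outcome.executes h

end Schedule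

/-! ### Orders of execution -/

theorem StateMachine.Conflict.symm {S Op R : Type*} {M : StateMachine S Op R} {a b : Op}
    (h : M.Conflict a b) : M.Conflict b a := fun hc =>
  h fun s => ⟨(hc s).1.symm, (hc s).2.2, (hc s).2.1⟩

namespace Run

variable {n : ℕ} {Op S R : Type*} {P : Protocol n Op} {Δ : ℝ} {r r' : Run P Δ} {p q : Fin n}
  {c c' : Command Op} {k k' : ℕ}

theorem executesBefore_of_lt (h : c ∈ r.executes k p) (h' : c' ∈ r.executes k' p) (hk : k < k') :
    r.ExecutesBefore p c c' := by
  obtain ⟨i, hi⟩ := List.mem_iff_getElem?.mp h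
  obtain ⟨i', hi'⟩ := List.mem_iff_getElem?.mp h'
  exact ⟨k, i, k', i', hi, hi', Or.inl hk⟩

theorem executesBefore_or (hne : c ≠ c') (h : r.Executes p c) (h' : r.Executes p c') :
    r.ExecutesBefore p c c' ∨ r.ExecutesBefore p c' c := by
  obtain ⟨k, hk⟩ := h
  obtain ⟨k', hk'⟩ := h'
  obtain ⟨i, hi⟩ := List.mem_iff_getElem?.mp hk
  obtain ⟨i', hi'⟩ := List.mem_iff_getElem?.mp hk'
  rcases lt_trichotomy k k' with hlt | rfl | hlt
  · exact Or.inl (executesBefore_of_lt hk hk' hlt)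
  · rcases lt_trichotomy i i' with hlt | rfl | hlt
    · exact Or.inl ⟨k, i, k, i', hi, hi', Or.inr ⟨rfl, hlt⟩⟩
    · exact absurd (Option.some.inj (hi.symm.trans hi')) hne
    · exact Or.inr ⟨k, i', k, i, hi', hi, Or.inr ⟨rfl, hlt⟩⟩
  · exact Or.inr (executesBefore_of_lt hk' hk hlt)

/-- The order in which one replica executes two conflicting commands is imposed on all replicas
that execute both. -/
theorem Consistency.executesBefore {M : StateMachine S Op R} (hr : r.Consistency M) (hne : c ≠ c')
    (hc : M.Conflict c.op c'.op) (hp : r.ExecutesBefore p c c') (h : r.Executes q c)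
    (h' : r.Executes q c') : r.ExecutesBefore q c c' :=
  (executesBefore_or hne h h').resolve_right (hr p q c c' hne hc hp)

theorem Integrity.exists_le_of_executesBefore (hr : r.Integrity) (h : r.ExecutesBefore p c c')
    (hk : c' ∈ r.executes k p) : ∃ j ≤ k, c ∈ r.executes j p := by
  obtain ⟨a, i, a', i', h1, h2, hlt⟩ := h
  obtain ⟨i'', hi''⟩ := List.mem_iff_getElem?.mp hk
  obtain ⟨rfl, rfl⟩ := hr p c' _ _ _ _ h2 hi''
  exact ⟨a, by omega, List.mem_iff_getElem?.mpr ⟨i, h1⟩⟩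

/-- If two runs show the same executions at `p` up to the instant `T`, then they agree on the order
of two commands of which the later one is executed by then. -/
theorem Integrity.executesBefore_of_agree (hr : r.Integrity) {T : ℕ}
    (hT : ∀ j ≤ T, r.executes j p = r'.executes j p) (h : r.ExecutesBefore p c c') (hkT : k ≤ T)
    (hk : c' ∈ r.executes k p) : r'.ExecutesBefore p c c' := by
  obtain ⟨a, i, a', i', h1, h2, hlt⟩ := h
  obtain ⟨i'', hi''⟩ := List.mem_iff_getElem?.mp hk
  obtain ⟨rfl, rfl⟩ := hr p c' _ _ _ _ h2 hi''
  exact ⟨a, i, a', i', by rwa [← hT a (by omega)], by rwa [← hT a' hkT], hlt⟩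

end Run

/-! ### A single command in a synchronous run -/

/-- The instant at which a message sent at the instant `j` arrives in a synchronous run, if a round
lasts for `N` instants. -/
def nextRound (N j : ℕ) : ℕ := (j / N + 1) * N

theorem lt_nextRound {N : ℕ} (hN : 0 < N) (j : ℕ) : j < nextRound N j := by
  have := Nat.lt_mul_div_succ j hN
  rwa [nextRound, mul_comm]

theorem nextRound_le (N j : ℕ) : nextRound N j ≤ j + N := by
  have := Nat.div_mul_le_self j N
  rw [nextRound, Nat.add_mul, one_mul]
  omega

theorem le_nextRound (N j : ℕ) : N ≤ nextRound N j := Nat.le_mul_of_pos_left N (Nat.succ_pos _)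

theorem nextRound_of_lt {N j : ℕ} (h : j < N) : nextRound N j = N := by
  rw [nextRound, Nat.div_eq_of_lt h, zero_add, one_mul]

theorem two_mul_le_nextRound {N j : ℕ} (hN : 0 < N) (h : N ≤ j) : 2 * N ≤ nextRound N j :=
  Nat.mul_le_mul_right N (Nat.succ_le_succ ((Nat.one_le_div_iff hN).mpr h))

namespace Schedule

open Classical in
/-- The synchronous schedule in which the replicas in `E` crash at the beginning, and `c` is the
only command, submitted at `p` at the beginning. The replicas in `E` send nothing; the delivery
instant `0` means that messages from them never arrive. -/
noncomputable def solo {n N : ℕ} {Op : Type u} (hN : 0 < N) (E : Finset (Fin n)) (p : Fin n)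
    (hp : p ∉ E) (c : Command Op) : Schedule n N Op where
  crashAt x := if x ∈ E then 0 else ⊤
  gst := 0
  submits k x := if k = 0 ∧ x = p then [c] else []
  delivery src j _ := if src ∈ E then 0 else nextRound N j
  submits_alive k x h := by
    by_cases hx : k = 0 ∧ x = p
    · rw [hx.2, if_neg hp]
      exact WithTop.coe_lt_top _
    · simp [hx] at h
  submits_nodup k x := by split_ifs <;> simp
  submits_unique d k x k' x' h h' := by
    by_cases hx : k = 0 ∧ x = p
    · by_cases hx' : k' = 0 ∧ x' = p
      · exact ⟨hx.1.trans hx'.1.symm, hx.2.trans hx'.2.symm⟩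
      · simp [hx'] at h'
    · simp [hx] at h
  lt_delivery src j _ h := by
    by_cases hs : src ∈ E
    · simp [hs] at h
    · rw [if_neg hs]
      exact lt_nextRound hN j
  delivery_le src j _ _ := by
    have := nextRound_le N j
    split_ifs <;> omega

variable {n : ℕ} {Op : Type u} {S R : Type*} (P : Protocol.{u, v, w} n Op) {M : StateMachine S Op R}
  {Δ : ℝ} {f : ℕ}

theorem isSMR_of_crashAt (hΔ : 0 < Δ) (hres : P.Resilient M Δ f) (σ : Schedule n P.ticks Op)
    {F : Finset (Fin n)} (hF : F.card ≤ f) (h : ∀ x ∉ F, σ.crashAt x = ⊤) :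
    (σ.run P hΔ).IsSMR M := by
  refine hres _ (le_trans ?_ hF)
  rw [← Set.ncard_coe_finset]
  refine Set.ncard_le_ncard (fun x hx => ?_) F.finite_toSet
  by_contra hxF
  exact hx ((σ.run_correct_iff P hΔ x).mpr (h x hxF))

section Solo

variable (hΔ : 0 < Δ) {E : Finset (Fin n)} {p : Fin n} (hp : p ∉ E) {c : Command Op}

theorem solo_isSMR (hres : P.Resilient M Δ f) (hE : E.card ≤ f) :
    ((solo P.ticks_pos E p hp c).run P hΔ).IsSMR M :=
  isSMR_of_crashAt P hΔ hres _ hE fun _ hx => if_neg hx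

theorem eq_of_mem_solo_submits {N : ℕ} (hN : 0 < N) {k : ℕ} {x : Fin n} {d : Command Op}
    (h : d ∈ (solo hN E p hp c).submits k x) : d = c := by
  by_cases hx : k = 0 ∧ x = p
  · simpa [solo, hx] using h
  · simp [solo, hx] at h

theorem mem_solo_submits {N : ℕ} (hN : 0 < N) : c ∈ (solo hN E p hp c).submits 0 p := by
  simp [solo]

theorem eq_of_mem_solo_executes (hres : P.Resilient M Δ f) (hE : E.card ≤ f) {k : ℕ} {x : Fin n}
    {d : Command Op} (h : d ∈ ((solo P.ticks_pos E p hp c).run P hΔ).executes k x) : d = c := by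
  obtain ⟨k', p', -, h'⟩ := (solo_isSMR P hΔ hp hres hE).1 k x d h
  exact eq_of_mem_solo_submits hp P.ticks_pos h'

theorem solo_executes (hres : P.Resilient M Δ f) (hE : E.card ≤ f) :
    ((solo P.ticks_pos E p hp c).run P hΔ).Executes p c := by
  have hcor : ((solo P.ticks_pos E p hp c).run P hΔ).Correct p :=
    (run_correct_iff P _ hΔ p).mpr (if_neg hp)
  refine (solo_isSMR P hΔ hp hres hE).2.2.2 ?_ c
    (Or.inl ⟨0, p, hcor, mem_solo_submits hp P.ticks_pos⟩) p hcor
  refine (Set.finite_singleton c).subset ?_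
  rintro d ⟨k, x, h⟩
  exact eq_of_mem_solo_submits hp P.ticks_pos h

theorem solo_faultySynchronous :
    ((solo P.ticks_pos E p hp c).run P hΔ).FaultySynchronous E := by
  have hδ : 0 < Δ / P.ticks := div_pos hΔ (Nat.cast_pos.mpr P.ticks_pos)
  have hcor : ∀ x ∉ E, (solo P.ticks_pos E p hp c).crashAt x = ⊤ := fun x hx => if_neg hx
  refine ⟨fun x hx => ?_, fun x hx => (run_correct_iff P _ hΔ x).mpr (hcor x hx), ?_, ?_⟩
  · have : (solo P.ticks_pos E p hp c).crashAt x = ((0 : ℕ) : WithTop ℕ) := if_pos hx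
    change (solo P.ticks_pos E p hp c).crashTime P Δ x = 0
    rw [crashTime, this]
    change (((0 : ℕ) * (Δ / P.ticks) : ℝ) : WithTop ℝ) = 0
    simp
  · change ((0 : ℕ) : ℝ) * _ = 0
    simp
  · intro i x m j hx hm h1 h2
    change (i.instant : ℝ) * (Δ / P.ticks) < _ at h2
    change _ ≤ (i.instant : ℝ) * (Δ / P.ticks) at h1
    change ((solo P.ticks_pos E p hp c).sent P Δ i.instant i.src)[i.idx]? = _ at hm
    have hsrc : i.src ∉ E := by
      intro hs
      have : ¬ (i.instant : WithTop ℕ) < (solo P.ticks_pos E p hp c).crashAt i.src := by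
        simp [solo, hs]
      simp [sent, outcome_of_dead P Δ _ this] at hm
    have hj : i.instant / P.ticks = j := by
      have hround : ∀ a : ℝ, a * Δ = a * P.ticks * (Δ / P.ticks) := fun a => by
        rw [mul_assoc, ticks_mul P hΔ]
      rw [hround] at h1 h2
      have h1' := le_of_mul_le_mul_right h1 hδ
      have h2' := lt_of_mul_lt_mul_right h2 hδ.le
      exact Nat.div_eq_of_lt_le (by exact_mod_cast h1') (by exact_mod_cast h2')
    have hdel : (solo P.ticks_pos E p hp c).delivery i.src i.instant x = (j + 1) * P.ticks := by
      rw [← hj]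
      exact if_neg hsrc
    refine ⟨(j + 1) * P.ticks, (mem_arrivals P _).mpr ⟨?_, ?_, hdel, m, hm⟩, ?_⟩
    · rw [hcor x hx]
      exact WithTop.coe_lt_top _
    · rw [← hj]
      exact lt_nextRound P.ticks_pos i.instant
    · change (((j + 1) * P.ticks : ℕ) : ℝ) * (Δ / P.ticks) = _
      push_cast
      rw [mul_assoc, ticks_mul P hΔ]

/-- A command that is submitted alone to a fast protocol is executed at its replica within two
rounds. -/
theorem solo_executes_fast {e : ℕ} (hfast : P.Fast M Δ e) (hE : E.card = e) :
    ∃ k ≤ 2 * P.ticks, c ∈ ((solo P.ticks_pos E p hp c).run P hΔ).executes k p := by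
  have hδ : 0 < Δ / P.ticks := div_pos hΔ (Nat.cast_pos.mpr P.ticks_pos)
  obtain ⟨k, hk, hle⟩ := hfast E hE _ (solo_faultySynchronous P hΔ hp) c 0 p
    (mem_solo_submits hp P.ticks_pos) (by
      rintro d ⟨k, x, h⟩ hne
      exact absurd (eq_of_mem_solo_submits hp P.ticks_pos h) hne)
  refine ⟨k, ?_, hk⟩
  change (k : ℝ) * (Δ / P.ticks) ≤ ((0 : ℕ) : ℝ) * (Δ / P.ticks) + 2 * Δ at hle
  have : (k : ℝ) * (Δ / P.ticks) ≤ (2 * P.ticks : ℕ) * (Δ / P.ticks) := by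
    push_cast
    rw [mul_assoc, ticks_mul P hΔ]
    simpa using hle
  exact_mod_cast le_of_mul_le_mul_right this hδ

end Solo

end Schedule

namespace Schedule

variable {n : ℕ} {Op : Type u} {S R : Type*}

/-! ### Two conflicting proposals -/

/-- The two competing commands, with conflicting operations `op false` and `op true`. -/
def proposal (op : Bool → Op) (b : Bool) : Command Op := ⟨op b, b.toNat⟩

/-- Commands that conflict with `proposal op b`, to be submitted later. -/
def probe (op : Bool → Op) (b : Bool) : Command Op := ⟨op !b, 2 + b.toNat⟩

theorem proposal_injective (op : Bool → Op) : Function.Injective (proposal op) := by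
  intro a b h
  have := congrArg Command.tag h
  cases a <;> cases b <;> simp_all [proposal]

theorem probe_injective (op : Bool → Op) : Function.Injective (probe op) := by
  intro a b h
  have := congrArg Command.tag h
  cases a <;> cases b <;> simp_all [probe]

theorem proposal_ne_probe (op : Bool → Op) (a b : Bool) : proposal op a ≠ probe op b := by
  intro h
  have := congrArg Command.tag h
  have h2 := Bool.toNat_lt a
  simp only [proposal, probe] at this
  omega

/-- At the beginning, the replicas `p false` and `p true` submit one proposal each. -/
def proposals (p : Bool → Fin n) (op : Bool → Op) (k : ℕ) (x : Fin n) : List (Command Op) :=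
  if k = 0 then
    if x = p false then [proposal op false] else if x = p true then [proposal op true] else []
  else []

theorem mem_proposals {p : Bool → Fin n} (hp : p false ≠ p true) {op : Bool → Op} {k : ℕ}
    {x : Fin n} {d : Command Op} :
    d ∈ proposals p op k x ↔ ∃ b, d = proposal op b ∧ k = 0 ∧ x = p b := by
  unfold proposals
  rw [Bool.exists_bool]
  split_ifs with h1 h2 h3
  · subst h2; simp [h1, hp]
  · subst h3; simp [h1, hp.symm]
  · simp [h2, h3]
  · simp [h1]

theorem proposals_nodup (p : Bool → Fin n) (op : Bool → Op) (k : ℕ) (x : Fin n) :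
    (proposals p op k x).Nodup := by
  unfold proposals
  split_ifs <;> simp

theorem proposals_eq {p : Bool → Fin n} {op : Bool → Op} {b : Bool} {k : ℕ} {x : Fin n}
    (hx : x ≠ p !b) : proposals p op k x = if k = 0 ∧ x = p b then [proposal op b] else [] := by
  unfold proposals
  cases b <;> simp only [Bool.not_false, Bool.not_true] at hx <;> by_cases hk : k = 0 <;>
    simp [hk, hx]

theorem proposals_unique {p : Bool → Fin n} (hp : p false ≠ p true) {op : Bool → Op}
    (d : Command Op) (k : ℕ) (x : Fin n) (k' : ℕ) (x' : Fin n) (h : d ∈ proposals p op k x)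
    (h' : d ∈ proposals p op k' x') : k = k' ∧ x = x' := by
  obtain ⟨b, rfl, rfl, rfl⟩ := (mem_proposals hp).mp h
  obtain ⟨b', hb, rfl, rfl⟩ := (mem_proposals hp).mp h'
  rw [proposal_injective op hb]
  exact ⟨rfl, rfl⟩

/-! ### Resilience requires a correct majority -/

/-- A failure-free schedule in which messages between the replicas outside `E false` and those
outside `E true` are delayed until after the instant `T`. -/
def partitioned {N : ℕ} (hN : 0 < N) (E : Bool → Finset (Fin n)) {p : Bool → Fin n}
    (hp : p false ≠ p true) (op : Bool → Op) (T : ℕ) : Schedule n N Op where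
  crashAt _ := ⊤
  gst := T
  submits := proposals p op
  delivery src j dst :=
    if ∃ b, src ∉ E b ∧ dst ∉ E b then nextRound N j else max T j + 1
  submits_alive _ _ _ := WithTop.coe_lt_top _
  submits_nodup := proposals_nodup p op
  submits_unique := proposals_unique hp
  lt_delivery src j dst _ := by
    have := lt_nextRound hN j
    split_ifs <;> omega
  delivery_le src j dst _ := by
    have := nextRound_le N j
    split_ifs <;> omega

variable (P : Protocol.{u, v, w} n Op) {M : StateMachine S Op R} {Δ : ℝ} {f : ℕ}

/-- Until the instant `T`, a partition does not notice that the other one is alive. -/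
theorem partitioned_outcome {E : Bool → Finset (Fin n)} (hE : ∀ b x, x ∈ E (!b) ↔ x ∉ E b)
    {p : Bool → Fin n} (hpE : ∀ b, p b ∉ E b) (hp : p false ≠ p true) (op : Bool → Op) (T : ℕ)
    (b : Bool) {k : ℕ} (hk : k ≤ T) {x : Fin n} (hx : x ∉ E b) :
    (solo P.ticks_pos (E b) (p b) (hpE b) (proposal op b)).outcome P Δ k x =
      (partitioned P.ticks_pos E hp op T).outcome P Δ k x := by
  refine outcome_eq_of_agree P Δ (fun k x => k ≤ T ∧ x ∉ E b) (fun k x h => ⟨by omega, h.2⟩)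
    ?_ ?_ ?_ ?_ k x ⟨hk, hx⟩
  · rintro k x ⟨-, hx⟩
    simp [solo, partitioned, hx]
  · rintro k x ⟨-, hx⟩
    refine (proposals_eq (b := b) ?_).symm
    rintro rfl
    exact hpE (!b) ((hE b _).mpr hx)
  · rintro k x ⟨hk, hx⟩ src j hj
    by_cases hs : src ∈ E b
    · have : ¬ ∃ a, src ∉ E a ∧ x ∉ E a := by
        rintro ⟨a, h1, h2⟩
        by_cases hab : a = b
        · exact h1 (hab ▸ hs)
        · rw [Bool.eq_not_of_ne hab] at h2
          exact h2 ((hE b x).mpr hx)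
      simp only [solo, partitioned, hs, this, if_true, if_false]
      omega
    · have : ∃ a, src ∉ E a ∧ x ∉ E a := ⟨b, hs, hx⟩
      simp only [solo, partitioned, hs, this, if_true, if_false]
  · rintro k x ⟨hk, -⟩ src j hj hd
    refine ⟨by omega, fun hs => ?_⟩
    simp only [solo, hs, if_true] at hd
    omega

/-- A resilient protocol cannot be split into two parts of at most `f` replicas each. -/
theorem not_resilient_of_partition (hΔ : 0 < Δ) {E : Bool → Finset (Fin n)}
    (hE : ∀ b x, x ∈ E (!b) ↔ x ∉ E b) (hcard : ∀ b, (E b).card ≤ f) {p : Bool → Fin n}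
    (hpE : ∀ b, p b ∉ E b) {op : Bool → Op} (hop : M.Conflict (op false) (op true)) :
    ¬ P.Resilient M Δ f := by
  intro hres
  have hp : p false ≠ p true := fun h =>
    hpE true (h ▸ (hE false (p false)).mpr (hpE false))
  choose t ht using fun b => solo_executes P hΔ (hpE b) (c := proposal op b) hres (hcard b)
  set T := max (t false) (t true)
  have htT : ∀ b, t b ≤ T := by
    intro b
    cases b
    · exact le_max_left _ _
    · exact le_max_right _ _
  set r := (partitioned P.ticks_pos E hp op T).run P hΔ
  have hcor : ∀ x, r.Correct x := fun x => (run_correct_iff P _ hΔ x).mpr rfl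
  have hsmr : r.IsSMR M := isSMR_of_crashAt P hΔ hres _ (F := ∅) (by simp) fun _ _ => rfl
  have hfin : {c | r.Submitted c}.Finite := by
    refine (Set.finite_range (proposal op)).subset ?_
    rintro d ⟨k, x, h⟩
    obtain ⟨b, rfl, -⟩ := (mem_proposals hp).mp h
    exact ⟨b, rfl⟩
  have heq : ∀ b, ∀ k ≤ T, r.executes k (p b) =
      ((solo P.ticks_pos (E b) (p b) (hpE b) (proposal op b)).run P hΔ).executes k (p b) :=
    fun b k hk => (executes_eq_of_outcome_eq P hΔ
      (partitioned_outcome P hE hpE hp op T b hk (hpE b))).symm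
  have hbefore : ∀ b, r.ExecutesBefore (p b) (proposal op b) (proposal op !b) := by
    intro b
    obtain ⟨k, hk⟩ := hsmr.2.2.2 hfin (proposal op !b)
      (Or.inl ⟨0, p !b, hcor _, (mem_proposals hp).mpr ⟨!b, rfl, rfl, rfl⟩⟩) (p b) (hcor _)
    refine Run.executesBefore_of_lt (k := t b) (heq b (t b) (htT b) ▸ ht b) hk ?_
    by_contra! hle
    rw [heq b k (hle.trans (htT b))] at hk
    have := proposal_injective op (eq_of_mem_solo_executes P hΔ (hpE b) hres (hcard b) hk)
    simp at this
  exact hsmr.2.2.1 _ _ _ _ ((proposal_injective op).ne Bool.false_ne_true) hop (hbefore false)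
    (hbefore true)

theorem two_mul_lt_of_resilient (hΔ : 0 < Δ) (hM : ∃ a b : Op, M.Conflict a b) (hn : 2 ≤ n)
    (hres : P.Resilient M Δ f) : 2 * f < n := by
  by_contra! hf
  obtain ⟨a, b, hab⟩ := hM
  obtain ⟨A, -, hA⟩ := Finset.exists_subset_card_eq
    (s := (Finset.univ : Finset (Fin n))) (n := n / 2) (by simp; omega)
  have hAc : Aᶜ.card = n - n / 2 := by rw [Finset.card_compl, hA, Fintype.card_fin]
  obtain ⟨x, hx⟩ := Finset.card_pos.mp (by omega : 0 < A.card)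
  obtain ⟨y, hy⟩ := Finset.card_pos.mp (by omega : 0 < Aᶜ.card)
  refine not_resilient_of_partition P hΔ (E := fun b => bif b then Aᶜ else A)
    (p := fun b => bif b then x else y) (op := fun i => bif i then b else a) ?_ ?_ ?_ hab hres
  · intro b z
    cases b <;> simp
  · intro b
    cases b
    · exact hA.trans_le (by omega)
    · exact hAc.trans_le (by omega)
  · intro b
    cases b
    · simpa using hy
    · simpa using hx

end Schedule

namespace Schedule

variable {n : ℕ} {Op : Type u} {S R : Type*}

/-! ### Fast decisions that only the survivors could reveal -/

/-- The replicas and operations of the indistinguishability argument. For each `b`, the replica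
`p b` proposes `op b` and decides fast without hearing from the replicas in `E b`, among which the
other proposer is. The survivors `Q` do not include the proposers, and none of them supports both
proposals, that is, lies outside both `E false` and `E true`. The survivor `x` submits the probes. -/
structure Duel (n : ℕ) (Op : Type u) where
  E : Bool → Finset (Fin n)
  p : Bool → Fin n
  Q : Finset (Fin n)
  x : Fin n
  op : Bool → Op
  notMem : ∀ b, p b ∉ E b
  mem_other : ∀ b, p (!b) ∈ E b
  notMem_Q : ∀ b, p b ∉ Q
  mem_of_mem_Q : ∀ b, ∀ y ∈ Q, y ∉ E b → y ∈ E (!b)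
  x_mem : x ∈ Q

namespace Duel

variable (D : Duel n Op) {N : ℕ}

theorem p_ne : D.p false ≠ D.p true := fun h => D.notMem true (h ▸ D.mem_other true)

theorem ne_other {b : Bool} {y : Fin n} (hy : y ∉ D.E b) : y ≠ D.p !b := by
  rintro rfl
  exact hy (D.mem_other b)

/-- The proposals are submitted at the beginning, and the probes at the start of the third round,
too late to have an influence on the fast decisions. -/
def submissions (N k : ℕ) (y : Fin n) : List (Command Op) :=
  if k = 2 * N ∧ y = D.x then [probe D.op false, probe D.op true] else proposals D.p D.op k y

theorem mem_submissions {k : ℕ} {y : Fin n} {d : Command Op} (hN : 0 < N) :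
    d ∈ D.submissions N k y ↔ (∃ b, d = proposal D.op b ∧ k = 0 ∧ y = D.p b) ∨
      ∃ b, d = probe D.op b ∧ k = 2 * N ∧ y = D.x := by
  unfold submissions
  split_ifs with h
  · obtain ⟨rfl, rfl⟩ := h
    have : 2 * N ≠ 0 := by omega
    simp [this]
  · rw [mem_proposals D.p_ne]
    constructor
    · exact Or.inl
    · rintro (h' | ⟨b, -, h'⟩)
      · exact h'
      · exact absurd h' h

theorem submissions_nodup (k : ℕ) (y : Fin n) : (D.submissions N k y).Nodup := by
  unfold submissions
  split_ifs
  · simpa using (probe_injective D.op).ne Bool.false_ne_true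
  · exact proposals_nodup _ _ _ _

theorem submissions_unique (hN : 0 < N) (d : Command Op) (k : ℕ) (y : Fin n) (k' : ℕ) (y' : Fin n)
    (h : d ∈ D.submissions N k y) (h' : d ∈ D.submissions N k' y') : k = k' ∧ y = y' := by
  rcases (D.mem_submissions hN).mp h with ⟨b, hb, rfl, rfl⟩ | ⟨b, hb, rfl, rfl⟩ <;>
    rcases (D.mem_submissions hN).mp h' with ⟨b', hb', rfl, rfl⟩ | ⟨b', hb', rfl, rfl⟩
  · rw [proposal_injective D.op (hb.symm.trans hb')]
    exact ⟨rfl, rfl⟩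
  · exact absurd (hb.symm.trans hb') (proposal_ne_probe _ _ _)
  · exact absurd (hb'.symm.trans hb) (proposal_ne_probe _ _ _)
  · exact ⟨rfl, rfl⟩

/-- The delivery of the messages that the survivors receive, whoever decides fast. In the first
round only the messages among the supporters of the same proposal arrive in time; the others are
delayed beyond the fast decisions. -/
def coreDelivery (N : ℕ) (src : Fin n) (j : ℕ) (dst : Fin n) : ℕ :=
  if j < N then if ∃ b, src ∉ D.E b ∧ dst ∉ D.E b then N else 3 * N else j + N

theorem lt_coreDelivery (hN : 0 < N) (src : Fin n) (j : ℕ) (dst : Fin n) :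
    j < D.coreDelivery N src j dst := by
  unfold coreDelivery
  split_ifs <;> omega

theorem coreDelivery_le (src : Fin n) (j : ℕ) (dst : Fin n) :
    D.coreDelivery N src j dst ≤ max (2 * N) j + N := by
  unfold coreDelivery
  split_ifs <;> omega

theorem le_coreDelivery (src : Fin n) (j : ℕ) (dst : Fin n) :
    N ≤ D.coreDelivery N src j dst := by
  unfold coreDelivery
  split_ifs <;> omega

open Classical in
/-- The schedule in which all replicas but the survivors crash after the first round. The delivery
instant `0` means that the messages they would send later never arrive. -/
noncomputable def crashing (hN : 0 < N) : Schedule n N Op where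
  crashAt y := if y ∈ D.Q then ⊤ else N
  gst := 2 * N
  submits := D.submissions N
  delivery src j dst := if src ∈ D.Q ∨ j < N then D.coreDelivery N src j dst else 0
  submits_alive k y h := by
    by_cases hy : y ∈ D.Q
    · rw [if_pos hy]
      exact WithTop.coe_lt_top _
    · obtain ⟨d, hd⟩ := List.exists_mem_of_ne_nil _ h
      rcases (D.mem_submissions hN).mp hd with ⟨b, -, rfl, -⟩ | ⟨b, -, -, rfl⟩
      · rw [if_neg hy]
        exact_mod_cast hN
      · exact absurd D.x_mem hy
  submits_nodup := D.submissions_nodup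
  submits_unique := D.submissions_unique hN
  lt_delivery src j dst h := by
    have hsrc : src ∈ D.Q ∨ j < N := by
      by_contra! hs
      rw [if_neg hs.1] at h
      have : j < N := by exact_mod_cast h
      omega
    rw [if_pos hsrc]
    exact D.lt_coreDelivery hN _ _ _
  delivery_le src j dst _ := by
    have := D.coreDelivery_le (N := N) src j dst
    split_ifs <;> omega

open Classical in
/-- The failure-free schedule in which `p b` decides fast, but nothing that the replicas outside `Q`
send after the first round reaches the survivors before the instant `T`. -/
noncomputable def deciding (hN : 0 < N) (b : Bool) (T : ℕ) (hT : 2 * N ≤ T) : Schedule n N Op where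
  crashAt _ := ⊤
  gst := T
  submits := D.submissions N
  delivery src j dst :=
    if dst ∈ D.Q ∧ (src ∈ D.Q ∨ j < N) then D.coreDelivery N src j dst
    else if dst ∉ D.Q ∧ src ∉ D.E b ∧ dst ∉ D.E b ∧ j < 2 * N then nextRound N j
    else max T j + 1
  submits_alive _ _ _ := WithTop.coe_lt_top _
  submits_nodup := D.submissions_nodup
  submits_unique := D.submissions_unique hN
  lt_delivery src j dst _ := by
    have := D.lt_coreDelivery hN src j dst
    have := lt_nextRound hN j
    split_ifs <;> omega
  delivery_le src j dst _ := by
    have := D.coreDelivery_le (N := N) src j dst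
    have := nextRound_le N j
    split_ifs <;> omega

variable (P : Protocol.{u, v, w} n Op) {M : StateMachine S Op R} {Δ : ℝ} {f : ℕ}

/-- The survivors do not notice until the instant `T` whether the other replicas have crashed. -/
theorem crashing_outcome (b : Bool) {T : ℕ} (hT : 2 * P.ticks ≤ T) {k : ℕ} (hk : k ≤ T)
    {y : Fin n} (hy : y ∈ D.Q) :
    (D.crashing P.ticks_pos).outcome P Δ k y =
      (D.deciding P.ticks_pos b T hT).outcome P Δ k y := by
  have hN := P.ticks_pos
  refine outcome_eq_of_agree P Δ (σ := D.crashing hN) (τ := D.deciding hN b T hT)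
    (fun k y => k ≤ T ∧ (y ∈ D.Q ∨ k < P.ticks))
    (fun k y h => ⟨by omega, h.2.imp_right (by omega)⟩) ?_ (fun _ _ _ => rfl) ?_ ?_ k y
    ⟨hk, Or.inl hy⟩
  · rintro k y ⟨-, hy⟩
    refine iff_of_true ?_ (WithTop.coe_lt_top _)
    change (k : WithTop ℕ) < if y ∈ D.Q then ⊤ else (P.ticks : WithTop ℕ)
    split_ifs with hQ
    · exact WithTop.coe_lt_top _
    · exact_mod_cast hy.resolve_left hQ
  · rintro k y ⟨hk, hy⟩ src j hj
    simp only [crashing, deciding]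
    have h1 := D.le_coreDelivery (N := P.ticks) src j y
    have h2 := le_nextRound P.ticks j
    by_cases hQ : y ∈ D.Q
    · by_cases hs : src ∈ D.Q ∨ j < P.ticks
      · simp only [hQ, hs, and_self, if_true]
      · simp only [hQ, hs, and_false, not_true_eq_false, false_and, if_false]
        omega
    · have hy' := hy.resolve_left hQ
      simp only [hQ, false_and, if_false]
      split_ifs <;> omega
  · rintro k y ⟨hk, -⟩ src j hj hd
    refine ⟨by omega, ?_⟩
    by_contra hs
    simp only [crashing, hs, if_false] at hd
    omega

/-- Until its fast decision, `p b` does not notice that the replicas in `E b` are alive. -/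
theorem deciding_outcome (b : Bool) {T : ℕ} (hT : 2 * P.ticks ≤ T) {k : ℕ} (hk : k ≤ 2 * P.ticks) :
    (solo P.ticks_pos (D.E b) (D.p b) (D.notMem b) (proposal D.op b)).outcome P Δ k (D.p b) =
      (D.deciding P.ticks_pos b T hT).outcome P Δ k (D.p b) := by
  have hN := P.ticks_pos
  refine outcome_eq_of_agree P Δ
    (fun k y => y ∉ D.E b ∧ (k < 2 * P.ticks ∨ k = 2 * P.ticks ∧ y = D.p b))
    (fun k y h => ⟨h.1, by omega⟩) ?_ ?_ ?_ ?_ k (D.p b) ⟨D.notMem b, by omega⟩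
  · rintro k y ⟨hy, -⟩
    simp [solo, deciding, hy]
  · rintro k y ⟨hy, hk⟩
    have hprobe : ¬ (k = 2 * P.ticks ∧ y = D.x) := by
      rintro ⟨rfl, rfl⟩
      have : D.x = D.p b := by omega
      exact D.notMem_Q b (this ▸ D.x_mem)
    simp only [solo, deciding, submissions, hprobe, if_false]
    exact (proposals_eq (D.ne_other hy)).symm
  · rintro k y ⟨hy, hk⟩ src j hj
    have h1 := lt_nextRound hN j
    have h2 : P.ticks ≤ j → 2 * P.ticks ≤ nextRound P.ticks j := two_mul_le_nextRound hN
    have h3 : j < P.ticks → nextRound P.ticks j = P.ticks := nextRound_of_lt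
    have hj2 : j < 2 * P.ticks := by omega
    by_cases hQ : y ∈ D.Q
    · -- A survivor does not take part in the second step of the fast decision.
      have hk' : k < 2 * P.ticks := by
        refine hk.resolve_right ?_
        rintro ⟨-, rfl⟩
        exact D.notMem_Q b hQ
      have hex : (∃ a, src ∉ D.E a ∧ y ∉ D.E a) ↔ src ∉ D.E b := by
        refine ⟨?_, fun h => ⟨b, h, hy⟩⟩
        rintro ⟨a, ha, hya⟩
        by_cases hab : a = b
        · exact hab ▸ ha
        · rw [Bool.eq_not_of_ne hab] at hya
          exact absurd (D.mem_of_mem_Q b y hQ hy) hya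
      simp only [solo, deciding, coreDelivery, hQ, hex, hj2, hy, true_and, not_true_eq_false,
        false_and, if_false]
      split_ifs <;> omega
    · by_cases hs : src ∈ D.E b
      · simp only [solo, deciding, hQ, hs, hy, false_and, if_false, if_true, not_true_eq_false,
          and_false]
        omega
      · simp only [solo, deciding, hQ, hs, hy, hj2, false_and, if_false, if_true,
          not_false_eq_true, and_self]
  · rintro k y ⟨-, hk⟩ src j hj hd
    refine ⟨fun hs => ?_, by omega⟩
    simp only [solo, hs, if_true] at hd
    omega

/-- With at most `f` replicas besides the survivors, the survivors cannot find out which of the two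
conflicting proposals, if any, has been decided fast. The probes force them to execute both
proposals nevertheless, in an order that contradicts one of the fast decisions. -/
theorem not_resilient_of_fast (hΔ : 0 < Δ) {e : ℕ} (hE : ∀ b, (D.E b).card = e) (hef : e ≤ f)
    (hQ : D.Qᶜ.card ≤ f) (hop : M.Conflict (D.op false) (D.op true)) (hfast : P.Fast M Δ e) :
    ¬ P.Resilient M Δ f := by
  intro hres
  have hN := P.ticks_pos
  have hconf : ∀ b, M.Conflict (D.op b) (D.op !b) := by
    intro b
    cases b
    · exact hop
    · exact hop.symm
  have hsub : ∀ b, proposal D.op b ∈ D.submissions P.ticks 0 (D.p b) := fun b =>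
    (D.mem_submissions hN).mpr (Or.inl ⟨b, rfl, rfl, rfl⟩)
  have hsub' : ∀ b, probe D.op b ∈ D.submissions P.ticks (2 * P.ticks) D.x := fun b =>
    (D.mem_submissions hN).mpr (Or.inr ⟨b, rfl, rfl, rfl⟩)
  have hfin : {c | ∃ k y, c ∈ D.submissions P.ticks k y}.Finite := by
    refine ((Set.finite_range (proposal D.op)).union (Set.finite_range (probe D.op))).subset ?_
    rintro d ⟨k, y, h⟩
    rcases (D.mem_submissions hN).mp h with ⟨b, rfl, -⟩ | ⟨b, rfl, -⟩
    · exact Or.inl ⟨b, rfl⟩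
    · exact Or.inr ⟨b, rfl⟩
  -- The survivors execute both probes by some instant `T`, even if the other replicas have crashed.
  set g := (D.crashing hN).run P hΔ
  have hg : g.IsSMR M := isSMR_of_crashAt P hΔ hres _ hQ fun y hy =>
    if_pos (by simpa using hy)
  have hgx : g.Correct D.x := (run_correct_iff P _ hΔ D.x).mpr (if_pos D.x_mem)
  choose t ht using fun b => hg.2.2.2 hfin (probe D.op b)
    (Or.inl ⟨2 * P.ticks, D.x, hgx, hsub' b⟩) D.x hgx
  obtain ⟨T, hT, htT⟩ : ∃ T, 2 * P.ticks ≤ T ∧ ∀ b, t b ≤ T := by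
    refine ⟨max (2 * P.ticks) (max (t false) (t true)), le_max_left _ _, fun b => ?_⟩
    cases b <;> omega
  let r : Bool → Run P Δ := fun b => (D.deciding hN b T hT).run P hΔ
  have hcor : ∀ b y, (r b).Correct y := fun b y => (run_correct_iff P _ hΔ y).mpr rfl
  have hr : ∀ b, (r b).IsSMR M := fun b =>
    isSMR_of_crashAt P hΔ hres _ (F := ∅) (by simp) fun _ _ => rfl
  have hview : ∀ b, ∀ k ≤ T, g.executes k D.x = (r b).executes k D.x := fun b k hk =>
    executes_eq_of_outcome_eq P hΔ (D.crashing_outcome P b hT hk D.x_mem)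
  have hall : ∀ b k y d, d ∈ D.submissions P.ticks k y → ∀ z, (r b).Executes z d :=
    fun b k y d hd z => (hr b).2.2.2 hfin d (Or.inl ⟨k, y, hcor b y, hd⟩) z (hcor b z)
  -- In `r b`, the replica `p b` executes its proposal before it could know any other command.
  have hfirst : ∀ b d, d ≠ proposal D.op b → (∃ k y, d ∈ D.submissions P.ticks k y) →
      (r b).ExecutesBefore (D.p b) (proposal D.op b) d := by
    rintro b d hne ⟨k, y, hd⟩
    obtain ⟨a, ha, hmem⟩ := solo_executes_fast P hΔ (D.notMem b) (c := proposal D.op b) hfast (hE b)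
    have heq : ∀ k ≤ 2 * P.ticks, (r b).executes k (D.p b) =
        ((solo hN (D.E b) (D.p b) (D.notMem b) (proposal D.op b)).run P hΔ).executes k (D.p b) :=
      fun k hk => (executes_eq_of_outcome_eq P hΔ (D.deciding_outcome P b hT hk)).symm
    obtain ⟨a', ha'⟩ := hall b k y d hd (D.p b)
    refine Run.executesBefore_of_lt (heq a ha ▸ hmem) ha' ?_
    by_contra! hle
    rw [heq a' (hle.trans ha)] at ha'
    exact hne (eq_of_mem_solo_executes P hΔ (D.notMem b) hres ((hE b).trans_le hef) ha')
  have horder : ∀ b, (r b).ExecutesBefore D.x (proposal D.op b) (proposal D.op !b) := fun b => by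
    have hne : proposal D.op b ≠ proposal D.op !b := (proposal_injective D.op).ne (by simp)
    exact (hr b).2.2.1.executesBefore hne (hconf b) (hfirst b _ hne.symm ⟨_, _, hsub !b⟩)
      (hall b _ _ _ (hsub b) _) (hall b _ _ _ (hsub !b) _)
  -- The proposal precedes the conflicting probe, hence is executed by the instant `T`.
  have hearly : ∀ b, ∃ k ≤ T, proposal D.op b ∈ g.executes k D.x := fun b => by
    have hne : proposal D.op b ≠ probe D.op b := proposal_ne_probe _ _ _
    have hbefore := (hr b).2.2.1.executesBefore hne (hconf b)
      (hfirst b _ hne.symm ⟨_, _, hsub' b⟩) (hall b _ _ _ (hsub b) D.x)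
      (hall b _ _ _ (hsub' b) D.x)
    obtain ⟨k, hk, hmem⟩ := Run.Integrity.exists_le_of_executesBefore (hr b).2.1 hbefore
      (hview b _ (htT b) ▸ ht b)
    exact ⟨k, hk.trans (htT b), hview b k (hk.trans (htT b)) ▸ hmem⟩
  obtain ⟨k, hk, hmem⟩ := hearly true
  refine (hr true).2.2.1 _ _ _ _ ((proposal_injective D.op).ne Bool.false_ne_true) hop
    (Run.Integrity.executesBefore_of_agree (hr false).2.1 (fun j hj => ?_) (horder false) hk
      (hview false k hk ▸ hmem)) (horder true)
  rw [← hview false j hj, hview true j hj]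

end Duel

/-- Below the bound, the replicas and sets of the indistinguishability argument exist: besides one
proposer each, the sets `E false` and `E true` contain `e - 1` further replicas, chosen so that their
union misses as few replicas as possible. -/
theorem exists_duel {e f : ℕ} (hn : n + 2 ≤ 2 * e + f) (hf : 2 * f + 1 ≤ n) (hef : e ≤ f)
    (op : Bool → Op) :
    ∃ D : Duel n Op, (∀ b, (D.E b).card = e) ∧ D.Qᶜ.card ≤ f ∧ D.op = op := by
  have : NeZero n := ⟨by omega⟩
  have hcard : ∀ s : Finset (Fin n), s.card + sᶜ.card = n := fun s => by simp
  let p : Bool → Fin n := fun b => bif b then ⟨1, by omega⟩ else ⟨0, by omega⟩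
  have hp : p false ≠ p true := by simp [p, Fin.ext_iff]
  have hpair := hcard {p false, p true}
  rw [Finset.card_pair hp] at hpair
  obtain ⟨A, hA, hAcard⟩ := Finset.exists_subset_card_eq
    (s := ({p false, p true} : Finset (Fin n))ᶜ) (n := e - 1) (by omega)
  obtain ⟨B, hB, hBcard, hAB⟩ : ∃ B ⊆ ({p false, p true} : Finset (Fin n))ᶜ, B.card = e - 1 ∧
      n ≤ (A ∪ B).card + f := by
    have hsd := Finset.card_sdiff_add_card_eq_card hA
    rcases le_total (e - 1) (({p false, p true} : Finset (Fin n))ᶜ \ A).card with h | h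
    · obtain ⟨B, hB, hBcard⟩ := Finset.exists_subset_card_eq h
      have hdis : Disjoint A B := Finset.disjoint_of_subset_right hB Finset.disjoint_sdiff
      refine ⟨B, hB.trans Finset.sdiff_subset, hBcard, ?_⟩
      rw [Finset.card_union_of_disjoint hdis]
      omega
    · obtain ⟨B, hB, hB', hBcard⟩ := Finset.exists_subsuperset_card_eq
        (Finset.sdiff_subset (s := ({p false, p true} : Finset (Fin n))ᶜ) (t := A)) h (by omega)
      refine ⟨B, hB', hBcard, ?_⟩
      have : ({p false, p true} : Finset (Fin n))ᶜ ⊆ A ∪ B := fun y hy => by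
        by_cases hyA : y ∈ A
        · exact Finset.mem_union_left _ hyA
        · exact Finset.mem_union_right _ (hB (Finset.mem_sdiff.mpr ⟨hy, hyA⟩))
      have := Finset.card_le_card this
      omega
  have hpA : ∀ b, p b ∉ A := fun b h => by
    have := hA h
    cases b <;> simp at this
  have hpB : ∀ b, p b ∉ B := fun b h => by
    have := hB h
    cases b <;> simp at this
  obtain ⟨x, hx⟩ := Finset.card_pos.mp (by omega : 0 < (A ∪ B).card)
  have hne : ∀ b, ∀ y ∈ A ∪ B, y ≠ p b := by
    rintro b y hy rfl
    rcases Finset.mem_union.mp hy with h | h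
    · exact hpA b h
    · exact hpB b h
  refine ⟨{ E := fun b => insert (p !b) (bif b then B else A), p := p, Q := A ∪ B, x := x, op := op,
            notMem := ?_, mem_other := ?_, notMem_Q := ?_, mem_of_mem_Q := ?_, x_mem := hx },
    ?_, ?_, rfl⟩
  · intro b
    cases b
    · simpa [hpA] using hp
    · simpa [hpB] using hp.symm
  · intro b
    exact Finset.mem_insert_self _ _
  · exact fun b h => hne b _ h rfl
  · intro b y hy hyb
    have := Finset.mem_union.mp hy
    cases b <;> simp only [Finset.mem_insert, not_or, cond_true, cond_false, Bool.not_false,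
      Bool.not_true] at hyb ⊢ <;> tauto
  · intro b
    cases b
    · exact (Finset.card_insert_of_notMem (hpA true)).trans (by omega)
    · exact (Finset.card_insert_of_notMem (hpB false)).trans (by omega)
  · have := hcard (A ∪ B)
    change (A ∪ B)ᶜ.card ≤ f
    omega

end Schedule

end SMR

theorem theorem1 {S Op R : Type*} (M : SMR.StateMachine S Op R)
    (hM : ∃ a b : Op, M.Conflict a b)
    (n e f : ℕ) (hn : 3 ≤ n) (hef : e ≤ f) (Δ : ℝ) (hΔ : 0 < Δ)
    (P : SMR.Protocol n Op) (hres : P.Resilient M Δ f) (hfast : P.Fast M Δ e) :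
    max (2 * (e : ℤ) + (f : ℤ) - 1) (2 * (f : ℤ) + 1) ≤ (n : ℤ) := by
  have hf := SMR.Schedule.two_mul_lt_of_resilient P hΔ hM (by omega) hres
  have he : 2 * e + f ≤ n + 1 := by
    by_contra! h
    obtain ⟨a, b, hab⟩ := hM
    obtain ⟨D, hE, hQ, hop⟩ := SMR.Schedule.exists_duel (by omega : n + 2 ≤ 2 * e + f)
      (by omega : 2 * f + 1 ≤ n) hef (fun i => bif i then b else a)
    exact D.not_resilient_of_fast P hΔ hE hef hQ (by rw [hop]; exact hab) hfast hres
  omega
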